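/- All graphs are finite and simple, and need not be connected. A graph $G$ is \emph{distance-hereditary} if for every pair of vertices $u,v$ all induced (chordless) paths between $u$ and $v$ have the same length. An \emph{$\mathsf{L}$-segment} is the union of a vertical segment $\{x\}\times[y,y+h]$ and a horizontal segment $[x,x+w]\times\{y\}$ in the plane, with $h,w>0$; it is thus shaped like the letter $\mathsf{L}$, without rotation or reflection. An \emph{$\mathsf{L}$-embedding} of $G$ assigns to each vertex an $\mathsf{L}$-segment such that the $\mathsf{L}$-segments of two distinct vertices intersect if and only if the vertices are adjacent, and such that, whenever two vertices are adjacent, the horizontal segment of one of them crosses the vertical segment of the other at a point interior to both segments. A graph that admits an $\mathsf{L}$-embedding is an \emph{$\mathsf{L}$-graph}. \textbf{Corollary.} Every distance-hereditary graph is an $\mathsf{L}$-graph. -/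

import Mathlib

/-- A graph is distance-hereditary if, for every pair of vertices `u`, `v`, all induced
(that is, chordless) paths between `u` and `v` have the same length. -/
def SimpleGraph.IsDistanceHereditary {V : Type*} (G : SimpleGraph V) : Prop :=
  ∀ (u v : V) (p q : G.Walk u v),
    p.IsPath → p.IsChordless → q.IsPath → q.IsChordless → p.length = q.length

/-- An L-segment in the plane (second coordinate pointing upwards): a corner `(x, y)`, a vertical
arm of height `h > 0` going up from the corner, and a horizontal arm of width `w > 0` going right
from the corner. -/
structure LSegment where
  x : ℝ
  y : ℝ
  h : ℝ
  w : ℝ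
  h_pos : 0 < h
  w_pos : 0 < w

namespace LSegment

/-- The horizontal arm, a closed segment from `(x, y)` to `(x + w, y)`. -/
def horizontal (L : LSegment) : Set (ℝ × ℝ) :=
  {p | L.x ≤ p.1 ∧ p.1 ≤ L.x + L.w ∧ p.2 = L.y}

/-- The vertical arm, a closed segment from `(x, y)` to `(x, y + h)`. -/
def vertical (L : LSegment) : Set (ℝ × ℝ) :=
  {p | p.1 = L.x ∧ L.y ≤ p.2 ∧ p.2 ≤ L.y + L.h}

/-- The set of points of the plane that the L-segment occupies. -/
def carrier (L : LSegment) : Set (ℝ × ℝ) :=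
  L.horizontal ∪ L.vertical

/-- The horizontal arm of `K` crosses the vertical arm of `L`, at a point that is interior to
both arms. -/
def HorizontalCrossesVertical (K L : LSegment) : Prop :=
  K.x < L.x ∧ L.x < K.x + K.w ∧ L.y < K.y ∧ K.y < L.y + L.h

end LSegment

/-- An L-embedding of `G` with single crossings: every vertex is drawn as an L-segment, the
L-segments of two different vertices intersect if and only if the vertices are adjacent, and for
adjacent vertices the horizontal arm of one of the two crosses the vertical arm of the other. -/
structure SimpleGraph.IsLEmbedding {V : Type*} (G : SimpleGraph V) (L : V → LSegment) : Prop where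
  adj_iff : ∀ u v : V, u ≠ v → (G.Adj u v ↔ ((L u).carrier ∩ (L v).carrier).Nonempty)
  crosses : ∀ u v : V, G.Adj u v →
    (L u).HorizontalCrossesVertical (L v) ∨ (L v).HorizontalCrossesVertical (L u)

/-- An L-graph is a graph that admits an L-embedding. -/
def SimpleGraph.IsLGraph {V : Type*} (G : SimpleGraph V) : Prop :=
  ∃ L : V → LSegment, G.IsLEmbedding L

/-! Induction on the number of vertices. A nonempty distance-hereditary graph has an isolated
vertex, a pendant vertex or a pair of twins (`hasReduction`); delete such a vertex, draw the rest,
and reinsert it. An isolated vertex goes far away, a pendant vertex becomes a tiny L-segment at the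
top of its neighbour's vertical arm, and a twin becomes a slightly shifted copy. Small changes are
harmless: proper crossings are open conditions, and so is disjointness of closed arms.

For the reduction, take the distance levels from a vertex `r`. If the last level has an edge, its
component there is a module (all its vertices see the same vertices outside) with a common neighbour
below. Otherwise take a vertex of the last level with fewest neighbours: it is pendant, or its
neighbourhood is a module. A module with a common neighbour is `P₄`-free, so by Seinsche's theorem
it contains twins, which are twins in `G`. -/

/-! ### Geometry of L-segments and their perturbations. -/

namespace LSegment

/-- The union of the closed arms from `(x, y)` of height `h` and width `w`, which may be
degenerate, meets the L-segment `L`. -/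
def ArmsMeet (x y h w : ℝ) (L : LSegment) : Prop :=
  (y = L.y ∧ x ≤ L.x + L.w ∧ L.x ≤ x + w) ∨
  (x ≤ L.x ∧ L.x ≤ x + w ∧ L.y ≤ y ∧ y ≤ L.y + L.h) ∨
  (L.x ≤ x ∧ x ≤ L.x + L.w ∧ y ≤ L.y ∧ L.y ≤ y + h) ∨
  (x = L.x ∧ y ≤ L.y + L.h ∧ L.y ≤ y + h)

theorem inter_nonempty_iff (K L : LSegment) :
    (K.carrier ∩ L.carrier).Nonempty ↔ ArmsMeet K.x K.y K.h K.w L := by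
  have := K.h_pos
  have := K.w_pos
  have := L.h_pos
  have := L.w_pos
  constructor
  · rintro ⟨⟨a, b⟩, h₁, h₂⟩
    simp only [carrier, horizontal, vertical, Set.mem_union, Set.mem_ofPred_eq] at h₁ h₂
    rcases h₁ with ⟨h₁, h₁', h₁''⟩ | ⟨h₁, h₁', h₁''⟩ <;>
      rcases h₂ with ⟨h₂, h₂', h₂''⟩ | ⟨h₂, h₂', h₂''⟩
    · refine .inl ⟨?_, ?_, ?_⟩ <;> linarith
    · refine .inr (.inl ⟨?_, ?_, ?_, ?_⟩) <;> linarith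
    · refine .inr (.inr (.inl ⟨?_, ?_, ?_, ?_⟩)) <;> linarith
    · refine .inr (.inr (.inr ⟨?_, ?_, ?_⟩)) <;> linarith
  · rintro (⟨h₁, h₂, h₃⟩ | ⟨h₁, h₂, h₃, h₄⟩ | ⟨h₁, h₂, h₃, h₄⟩ | ⟨h₁, h₂, h₃⟩)
    · refine ⟨(max K.x L.x, K.y), .inl ⟨le_max_left _ _, ?_, rfl⟩,
        .inl ⟨le_max_right _ _, ?_, h₁⟩⟩ <;> refine max_le ?_ ?_ <;> linarith
    · exact ⟨(L.x, K.y), .inl ⟨h₁, h₂, rfl⟩, .inr ⟨rfl, h₃, h₄⟩⟩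
    · exact ⟨(K.x, L.y), .inr ⟨rfl, h₃, h₄⟩, .inl ⟨h₁, h₂, rfl⟩⟩
    · refine ⟨(K.x, max K.y L.y), .inr ⟨rfl, le_max_left _ _, ?_⟩,
        .inr ⟨h₁, le_max_right _ _, ?_⟩⟩ <;> refine max_le ?_ ?_ <;> linarith

theorem isClosed_armsMeet {x y h w : ℝ → ℝ} (hx : Continuous x) (hy : Continuous y)
    (hh : Continuous h) (hw : Continuous w) (L : LSegment) :
    IsClosed {e | ArmsMeet (x e) (y e) (h e) (w e) L} := by
  have hle : ∀ {f g : ℝ → ℝ}, Continuous f → Continuous g → IsClosed {e | f e ≤ g e} :=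
    fun hf hg => isClosed_le hf hg
  have heq : ∀ {f g : ℝ → ℝ}, Continuous f → Continuous g → IsClosed {e | f e = g e} :=
    fun hf hg => isClosed_eq hf hg
  have hor : ∀ {p q : ℝ → Prop}, IsClosed {e | p e} → IsClosed {e | q e} →
    IsClosed {e | p e ∨ q e} := fun hp hq => hp.union hq
  unfold ArmsMeet
  refine hor ((heq ?_ ?_).and ((hle ?_ ?_).and (hle ?_ ?_)))
    (hor ((hle ?_ ?_).and ((hle ?_ ?_).and ((hle ?_ ?_).and (hle ?_ ?_))))
    (hor ((hle ?_ ?_).and ((hle ?_ ?_).and ((hle ?_ ?_).and (hle ?_ ?_))))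
    ((heq ?_ ?_).and ((hle ?_ ?_).and (hle ?_ ?_))))) <;> fun_prop

/-- `K` and `L` are drawn correctly with respect to each other, if `a` says whether they represent
adjacent vertices. -/
def Represents (a : Prop) (K L : LSegment) : Prop :=
  (a ↔ ArmsMeet K.x K.y K.h K.w L) ∧
    (a → K.HorizontalCrossesVertical L ∨ L.HorizontalCrossesVertical K)

theorem armsMeet_of_crosses {K L : LSegment}
    (h : K.HorizontalCrossesVertical L ∨ L.HorizontalCrossesVertical K) :
    ArmsMeet K.x K.y K.h K.w L := by
  rcases h with ⟨h₁, h₂, h₃, h₄⟩ | ⟨h₁, h₂, h₃, h₄⟩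
  · exact .inr (.inl ⟨h₁.le, h₂.le, h₃.le, h₄.le⟩)
  · exact .inr (.inr (.inl ⟨h₁.le, h₂.le, h₃.le, h₄.le⟩))

theorem represents_of_crosses {a : Prop} (ha : a) {K L : LSegment}
    (h : K.HorizontalCrossesVertical L ∨ L.HorizontalCrossesVertical K) : Represents a K L :=
  ⟨iff_of_true ha (armsMeet_of_crosses h), fun _ => h⟩

theorem represents_of_not_armsMeet {a : Prop} (ha : ¬a) {K L : LSegment}
    (h : ¬ArmsMeet K.x K.y K.h K.w L) : Represents a K L :=
  ⟨iff_of_false ha h, fun h => absurd h ha⟩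

/-- Translation of an L-segment. -/
def translate (K : LSegment) (s t : ℝ) : LSegment where
  x := K.x + s
  y := K.y + t
  h := K.h
  w := K.w
  h_pos := K.h_pos
  w_pos := K.w_pos

open Filter Topology

theorem Represents.eventually_translate {a : Prop} {K L : LSegment} (hKL : Represents a K L)
    (s t : ℝ) : ∀ᶠ e in 𝓝[>] (0 : ℝ), Represents a (K.translate (e * s) (e * t)) L := by
  refine Filter.Eventually.filter_mono nhdsWithin_le_nhds ?_
  by_cases ha : a
  · have hlt : ∀ {f g : ℝ → ℝ}, Continuous f → Continuous g → f 0 < g 0 →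
        ∀ᶠ e in 𝓝 (0 : ℝ), f e < g e :=
      fun hf hg h => (isOpen_lt hf hg).mem_nhds h
    rcases hKL.2 ha with ⟨h₁, h₂, h₃, h₄⟩ | ⟨h₁, h₂, h₃, h₄⟩
    · filter_upwards [
        hlt (f := fun e => K.x + e * s) (g := fun _ => L.x) (by fun_prop) (by fun_prop) (by simpa),
        hlt (f := fun _ => L.x) (g := fun e => K.x + e * s + K.w) (by fun_prop) (by fun_prop)
          (by simpa),
        hlt (f := fun _ => L.y) (g := fun e => K.y + e * t) (by fun_prop) (by fun_prop) (by simpa),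
        hlt (f := fun e => K.y + e * t) (g := fun _ => L.y + L.h) (by fun_prop) (by fun_prop)
          (by simpa)] with e k₁ k₂ k₃ k₄
      exact represents_of_crosses ha (.inl ⟨k₁, k₂, k₃, k₄⟩)
    · filter_upwards [
        hlt (f := fun _ => L.x) (g := fun e => K.x + e * s) (by fun_prop) (by fun_prop) (by simpa),
        hlt (f := fun e => K.x + e * s) (g := fun _ => L.x + L.w) (by fun_prop) (by fun_prop)
          (by simpa),
        hlt (f := fun e => K.y + e * t) (g := fun _ => L.y) (by fun_prop) (by fun_prop) (by simpa),
        hlt (f := fun _ => L.y) (g := fun e => K.y + e * t + K.h) (by fun_prop) (by fun_prop)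
          (by simpa)] with e k₁ k₂ k₃ k₄
      exact represents_of_crosses ha (.inr ⟨k₁, k₂, k₃, k₄⟩)
  · have hc : IsClosed {e : ℝ | ArmsMeet (K.x + e * s) (K.y + e * t) K.h K.w L} :=
      isClosed_armsMeet (by fun_prop) (by fun_prop) (by fun_prop) (by fun_prop) L
    have h0 : (0 : ℝ) ∈ {e : ℝ | ArmsMeet (K.x + e * s) (K.y + e * t) K.h K.w L}ᶜ := by
      simpa using fun h => ha (hKL.1.2 h)
    filter_upwards [hc.isOpen_compl.mem_nhds h0] with e he
    exact represents_of_not_armsMeet ha he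

/-- At `e = 0` the small L-segment degenerates to the tip of the vertical arm of `K`. The tip is not
on `L`, since any contact is a proper crossing; closedness extends this to small `e`. -/
theorem eventually_not_armsMeet_tip {a : Prop} {K L : LSegment} (hKL : Represents a K L) :
    ∀ᶠ e in 𝓝[>] (0 : ℝ), ¬ArmsMeet (K.x - e) (K.y + K.h - e) (2 * e) (2 * e) L := by
  refine Filter.Eventually.filter_mono nhdsWithin_le_nhds ?_
  have hc : IsClosed {e : ℝ | ArmsMeet (K.x - e) (K.y + K.h - e) (2 * e) (2 * e) L} :=
    isClosed_armsMeet (by fun_prop) (by fun_prop) (by fun_prop) (by fun_prop) L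
  refine hc.isOpen_compl.mem_nhds fun h0 => ?_
  have := K.h_pos
  have := K.w_pos
  have := L.h_pos
  have := L.w_pos
  simp only [Set.mem_ofPred_eq, sub_zero, mul_zero] at h0
  have hm : ArmsMeet K.x K.y K.h K.w L := by
    rcases h0 with ⟨h₁, h₂, h₃⟩ | ⟨h₁, h₂, h₃, h₄⟩ | ⟨h₁, h₂, h₃, h₄⟩ | ⟨h₁, h₂, h₃⟩
    · refine .inr (.inr (.inl ⟨?_, ?_, ?_, ?_⟩)) <;> linarith
    · refine .inr (.inr (.inr ⟨?_, ?_, ?_⟩)) <;> linarith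
    · refine .inr (.inr (.inl ⟨?_, ?_, ?_, ?_⟩)) <;> linarith
    · refine .inr (.inr (.inr ⟨?_, ?_, ?_⟩)) <;> linarith
  rcases hKL.2 (hKL.1.2 hm) with ⟨k₁, k₂, k₃, k₄⟩ | ⟨k₁, k₂, k₃, k₄⟩ <;>
    rcases h0 with ⟨h₁, h₂, h₃⟩ | ⟨h₁, h₂, h₃, h₄⟩ | ⟨h₁, h₂, h₃, h₄⟩ | ⟨h₁, h₂, h₃⟩ <;>
    linarith

theorem eventually_not_armsMeet_atTop (L : LSegment) :
    ∀ᶠ e in atTop, ¬ArmsMeet e e 1 1 L := by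
  have := L.h_pos
  have := L.w_pos
  filter_upwards [eventually_gt_atTop (L.x + L.w), eventually_gt_atTop (L.y + L.h)] with e h₁ h₂
  rintro (⟨k₁, k₂, k₃⟩ | ⟨k₁, k₂, k₃, k₄⟩ | ⟨k₁, k₂, k₃, k₄⟩ | ⟨k₁, k₂, k₃⟩) <;> linarith

theorem Represents.symm {a : Prop} {K L : LSegment} (h : Represents a K L) : Represents a L K := by
  refine ⟨?_, fun ha => (h.2 ha).symm⟩
  rw [← inter_nonempty_iff, Set.inter_comm, inter_nonempty_iff]
  exact h.1

end LSegment

/-! ### Reinserting a vertex into a drawing. -/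

namespace SimpleGraph

open LSegment Filter Topology

variable {V : Type*} {G : SimpleGraph V}

theorem isLEmbedding_iff {L : V → LSegment} :
    G.IsLEmbedding L ↔ ∀ u v, u ≠ v → Represents (G.Adj u v) (L u) (L v) := by
  refine ⟨fun h u v huv => ⟨?_, h.crosses u v⟩, fun h => ⟨fun u v huv => ?_, fun u v huv => ?_⟩⟩
  · rw [h.adj_iff u v huv, inter_nonempty_iff]
  · rw [inter_nonempty_iff]
    exact (h u v huv).1
  · exact (h u v huv.ne).2 huv

theorem isLGraph_of_extension {v : V} {L : V → LSegment} {M : LSegment}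
    (hL : ∀ a b, a ≠ v → b ≠ v → a ≠ b → Represents (G.Adj a b) (L a) (L b))
    (hM : ∀ b, b ≠ v → Represents (G.Adj v b) M (L b)) : G.IsLGraph := by
  classical
  refine ⟨Function.update L v M, isLEmbedding_iff.2 fun a b hab => ?_⟩
  rcases eq_or_ne a v with rfl | ha
  · simpa [Function.update_of_ne hab.symm] using hM b hab.symm
  rcases eq_or_ne b v with rfl | hb
  · simpa [Function.update_of_ne hab, G.adj_comm] using (hM a hab).symm
  · simpa [Function.update_of_ne ha, Function.update_of_ne hb] using hL a b ha hb hab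

variable [Finite V] {v : V} {L : V → LSegment}

theorem isLGraph_of_isolated
    (hL : ∀ a b, a ≠ v → b ≠ v → a ≠ b → Represents (G.Adj a b) (L a) (L b))
    (hv : ∀ b, ¬G.Adj v b) : G.IsLGraph := by
  obtain ⟨e, he⟩ := (eventually_all.2 fun b => eventually_not_armsMeet_atTop (L b)).exists
  exact isLGraph_of_extension (M := ⟨e, e, 1, 1, one_pos, one_pos⟩) hL fun b _ =>
    represents_of_not_armsMeet (hv b) (he b)

theorem isLGraph_of_pendant {u : V} (huv : G.Adj v u)
    (hL : ∀ a b, a ≠ v → b ≠ v → a ≠ b → Represents (G.Adj a b) (L a) (L b))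
    (hv : ∀ b, G.Adj v b → b = u) : G.IsLGraph := by
  have h : ∀ b, ∀ᶠ e in 𝓝[>] (0 : ℝ), b ≠ v → b ≠ u →
      ¬ArmsMeet ((L u).x - e) ((L u).y + (L u).h - e) (2 * e) (2 * e) (L b) := by
    intro b
    by_cases hb : b = v ∨ b = u
    · exact .of_forall fun e h₁ h₂ => (hb.elim h₁ h₂).elim
    · push Not at hb
      filter_upwards [eventually_not_armsMeet_tip (hL u b huv.ne' hb.1 hb.2.symm)] with e he _ _
      exact he
  obtain ⟨e, he, he₀, he₁⟩ := ((eventually_all.2 h).and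
    (Ioo_mem_nhdsGT (L u).h_pos)).exists
  -- The horizontal arm of the new L-segment is centred on the vertical arm of `u`, at distance `e`
  -- below its tip.
  refine isLGraph_of_extension (M := ⟨(L u).x - e, (L u).y + (L u).h - e, 2 * e, 2 * e,
    by positivity, by positivity⟩) hL fun b hb => ?_
  rcases eq_or_ne b u with rfl | hbu
  · refine represents_of_crosses huv (.inl ⟨?_, ?_, ?_, ?_⟩) <;> dsimp only <;> linarith
  · exact represents_of_not_armsMeet (fun h => hbu (hv b h)) (he b hb hbu)

theorem isLGraph_of_twin {u : V} (huv : v ≠ u)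
    (hL : ∀ a b, a ≠ v → b ≠ v → a ≠ b → Represents (G.Adj a b) (L a) (L b))
    (hv : ∀ b, b ≠ v → b ≠ u → (G.Adj v b ↔ G.Adj u b)) : G.IsLGraph := by
  have h : ∀ (t : ℝ) (b), ∀ᶠ e in 𝓝[>] (0 : ℝ), b ≠ v → b ≠ u →
      Represents (G.Adj v b) ((L u).translate (e * 1) (e * t)) (L b) := by
    intro t b
    by_cases hb : b = v ∨ b = u
    · exact .of_forall fun e h₁ h₂ => (hb.elim h₁ h₂).elim
    · push Not at hb
      filter_upwards [(hL u b huv.symm hb.1 hb.2.symm).eventually_translate 1 t] with e he _ _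
      rwa [hv b hb.1 hb.2]
  have hpos := lt_min (L u).h_pos (L u).w_pos
  by_cases ha : G.Adj v u
  · obtain ⟨e, he, he₀, he₁⟩ := ((eventually_all.2 (h (-1))).and (Ioo_mem_nhdsGT hpos)).exists
    have he₂ := he₁.trans_le (min_le_left _ _)
    have he₃ := he₁.trans_le (min_le_right _ _)
    -- Shifted right and down, the copy has its vertical arm crossed by the horizontal arm of `u`.
    refine isLGraph_of_extension (M := (L u).translate (e * 1) (e * -1)) hL fun b hb => ?_
    rcases eq_or_ne b u with rfl | hbu
    · refine represents_of_crosses ha (.inr ⟨?_, ?_, ?_, ?_⟩) <;> dsimp only [LSegment.translate] <;>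
        linarith
    · exact he b hb hbu
  · obtain ⟨e, he, he₀, he₁⟩ := ((eventually_all.2 (h 1)).and (Ioo_mem_nhdsGT hpos)).exists
    -- Shifted right and up, the copy is nested inside the corner of `u` without touching it.
    refine isLGraph_of_extension (M := (L u).translate (e * 1) (e * 1)) hL fun b hb => ?_
    rcases eq_or_ne b u with rfl | hbu
    · refine represents_of_not_armsMeet ha ?_
      rintro (⟨k₁, k₂, k₃⟩ | ⟨k₁, k₂, k₃, k₄⟩ | ⟨k₁, k₂, k₃, k₄⟩ | ⟨k₁, k₂, k₃⟩) <;>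
        dsimp only [LSegment.translate] at * <;> linarith
    · exact he b hb hbu

end SimpleGraph

/-! ### Walks in distance-hereditary graphs. -/

namespace SimpleGraph

variable {V : Type*} {G : SimpleGraph V}

namespace Walk

theorem exists_shorter_of_chord {u v : V} (p : G.Walk u v) {i j : ℕ} (hij : i + 1 < j)
    (hj : j ≤ p.length) (h : G.Adj (p.getVert i) (p.getVert j)) :
    ∃ q : G.Walk u v, q.length < p.length ∧ q.support ⊆ p.support := by
  refine ⟨(p.take i).append (cons h (p.drop j)), ?_, fun x hx => ?_⟩
  · simp only [length_append, take_length, length_cons, drop_length]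
    omega
  · rw [mem_support_append_iff, support_cons, List.mem_cons] at hx
    rcases hx with hx | rfl | hx
    · exact (p.isSubwalk_take i).support_subset hx
    · exact p.getVert_mem_support i
    · exact (p.isSubwalk_drop j).support_subset hx

/-- A walk that is shortest among the walks within its support is a chordless path. -/
theorem isPath_and_isChordless_of_forall_le {u v : V} (p : G.Walk u v)
    (hp : ∀ q : G.Walk u v, q.support ⊆ p.support → p.length ≤ q.length) :
    p.IsPath ∧ p.IsChordless := by
  classical
  constructor
  · rw [← p.bypass_eq_self_of_length_le_length_bypass
      (hp _ p.support_bypass_subset_support)]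
    exact p.bypass_isPath
  · rw [isChordless_iff_forall_mem_edges]
    intro a b ha hb hab
    obtain ⟨i, rfl, hi⟩ := mem_support_iff_exists_getVert.1 ha
    obtain ⟨j, rfl, hj⟩ := mem_support_iff_exists_getVert.1 hb
    wlog hij : i ≤ j generalizing i j
    · rw [Sym2.eq_swap]
      exact this j hj hb i hi ha hab.symm (le_of_not_ge hij)
    have hne : i ≠ j := fun h => hab.ne (by rw [h])
    rcases eq_or_ne (i + 1) j with rfl | h1
    · exact p.mk_mem_edges_iff_exists.2 ⟨i, hj, rfl⟩
    · obtain ⟨q, hq, hqs⟩ := p.exists_shorter_of_chord (by omega) hj hab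
      exact absurd (hp q hqs) (not_le.2 hq)

end Walk

namespace IsDistanceHereditary

/-- A shortest walk within the support of `p` is a chordless path, and so is a geodesic of `G`;
hence their lengths agree. -/
theorem exists_walk_length_eq_dist (hG : G.IsDistanceHereditary) {u v : V} (p : G.Walk u v) :
    ∃ q : G.Walk u v, q.support ⊆ p.support ∧ q.length = G.dist u v := by
  classical
  obtain ⟨r, hr⟩ := p.reachable.exists_walk_length_eq_dist
  have hr' := r.isPath_and_isChordless_of_forall_le fun q _ => hr ▸ dist_le q
  have hex : ∃ n, ∃ q : G.Walk u v, q.support ⊆ p.support ∧ q.length = n :=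
    ⟨_, p, fun _ h => h, rfl⟩
  obtain ⟨q, hqs, hq⟩ := Nat.find_spec hex
  have hq' := q.isPath_and_isChordless_of_forall_le fun t ht =>
    hq ▸ Nat.find_min' hex ⟨t, List.Subset.trans ht hqs, rfl⟩
  exact ⟨q, hqs, (hG u v q r hq'.1 hq'.2 hr'.1 hr'.2).trans hr⟩

theorem induce (hG : G.IsDistanceHereditary) (s : Set V) : (G.induce s).IsDistanceHereditary := by
  have key : ∀ {u v : s} (p : (G.induce s).Walk u v), p.IsChordless →
      (p.map (Embedding.induce s).toHom).IsChordless := by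
    intro u v p hp
    rw [Walk.isChordless_iff_forall_mem_edges] at hp ⊢
    intro a b ha hb hab
    rw [Walk.support_map, List.mem_map] at ha hb
    obtain ⟨a, ha, rfl⟩ := ha
    obtain ⟨b, hb, rfl⟩ := hb
    rw [Walk.edges_map, List.mem_map]
    exact ⟨_, hp ha hb hab, rfl⟩
  intro u v p q hp hp' hq hq'
  have hinj : Function.Injective (Embedding.induce (G := G) s).toHom := Subtype.val_injective
  simpa only [Walk.length_map] using hG _ _ _ _ (hp.map hinj) (key p hp')
    (hq.map hinj) (key q hq')

/-- A walk between the ends of an induced path of length two contains a common neighbour of its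
ends. -/
theorem exists_common_neighbor (hG : G.IsDistanceHereditary) {u v a : V} (p : G.Walk u v)
    (huv : u ≠ v) (hn : ¬G.Adj u v) (ha : G.Adj u a) (hb : G.Adj a v) :
    ∃ s ∈ p.support, G.Adj u s ∧ G.Adj s v := by
  obtain ⟨q, hqs, hq⟩ := hG.exists_walk_length_eq_dist p
  have hd : G.dist u v ≤ 2 := dist_le (.cons ha (.cons hb .nil))
  cases q with
  | nil => exact absurd rfl huv
  | cons h q =>
    cases q with
    | nil => exact absurd h hn
    | cons h' q =>
      cases q with
      | nil => exact ⟨_, hqs (by simp), h, h'⟩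
      | cons h'' q =>
        simp only [Walk.length_cons] at hq
        omega

end IsDistanceHereditary

/-! ### Twins in `P₄`-free graphs. -/

/-- The vertex set `S` contains no induced path on four vertices. -/
def IsPFourFree (G : SimpleGraph V) (S : Finset V) : Prop :=
  ∀ ⦃a⦄, a ∈ S → ∀ ⦃b⦄, b ∈ S → ∀ ⦃c⦄, c ∈ S → ∀ ⦃d⦄, d ∈ S →
    G.Adj a b → G.Adj b c → G.Adj c d → ¬G.Adj a c → ¬G.Adj b d → G.Adj a d

theorem IsPFourFree.mono {S T : Finset V} (h : G.IsPFourFree S) (hTS : T ⊆ S) :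
    G.IsPFourFree T :=
  fun _ ha _ hb _ hc _ hd => h (hTS ha) (hTS hb) (hTS hc) (hTS hd)

/-- `P₄` is self-complementary: an induced path `a b c d` of `Gᶜ` is the induced path `b d a c` of
`G`. -/
theorem IsPFourFree.compl {S : Finset V} (h : G.IsPFourFree S) : Gᶜ.IsPFourFree S := by
  intro a ha b hb c hc d hd hab hbc hcd hac hbd
  by_contra had
  simp only [compl_adj, not_and, not_not] at hab hbc hcd hac hbd had
  have hac' : a ≠ c := fun e => hcd.2 (e ▸ had (e ▸ hcd.1))
  have hbd' : b ≠ d := fun e => hab.2 (e ▸ had (e ▸ hab.1))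
  have had' : a ≠ d := fun e => hcd.2 (e ▸ hac hac').symm
  exact hbc.2 (h hb hd ha hc (hbd hbd') (had had').symm (hac hac')
    (fun t => hab.2 t.symm) (fun t => hcd.2 t.symm))

namespace IsDistanceHereditary

/-- The ends of an induced `P₄` in `S` have the common neighbour `v`, so the `P₄` itself would have
to contain a common neighbour of its ends. -/
theorem isPFourFree_of_forall_adj (hG : G.IsDistanceHereditary) {S : Finset V} {v : V}
    (hv : ∀ s ∈ S, G.Adj v s) : G.IsPFourFree S := by
  intro a ha b hb c hc d hd hab hbc hcd hac hbd
  by_contra had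
  obtain ⟨s, hs, h₁, h₂⟩ := hG.exists_common_neighbor
    (Walk.cons hab (.cons hbc (.cons hcd .nil))) (by rintro rfl; exact hac hcd.symm) had
    (hv a ha).symm (hv d hd)
  simp only [Walk.support_cons, Walk.support_nil, List.mem_cons, List.not_mem_nil, or_false] at hs
  rcases hs with rfl | rfl | rfl | rfl
  · exact G.irrefl h₁
  · exact hbd h₂
  · exact hac h₁
  · exact had h₁

end IsDistanceHereditary

/-- `A` is a nonempty proper part of `S` that has no edges to the rest of `S`. -/
def IsSplit (G : SimpleGraph V) (S A : Finset V) : Prop :=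
  A ⊆ S ∧ A.Nonempty ∧ (∃ b ∈ S, b ∉ A) ∧ ∀ a ∈ A, ∀ b ∈ S, b ∉ A → ¬G.Adj a b

variable [DecidableEq V]

theorem IsSplit.sdiff {S A : Finset V} (h : G.IsSplit S A) : G.IsSplit S (S \ A) := by
  obtain ⟨h₁, ⟨a, ha⟩, ⟨b, hb, hb'⟩, h₂⟩ := h
  refine ⟨Finset.sdiff_subset, ⟨b, by simp [hb, hb']⟩, ⟨a, h₁ ha, by simp [ha]⟩, ?_⟩
  intro c hc d hd hd' hcd
  simp only [Finset.mem_sdiff, not_and, not_not] at hc hd'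
  exact h₂ d (hd' hd) c hc.1 hc.2 hcd.symm

/-- If `x` sees all of `S`, then `{x}` splits the complement. Otherwise `x` misses some `y`, say in
`A`. If `x` sees some `z` outside `A`, the non-neighbours of `x` in `A` split off: an edge from such
a `u` to a neighbour `t` of `x` in `A` would give the `P₄` `u t x z`. If not, `S \ A` splits off. -/
theorem IsSplit.exists_insert {S A : Finset V} {x : V} (hA : G.IsSplit S A) (hx : x ∉ S)
    (hS : G.IsPFourFree (insert x S)) :
    ∃ B, G.IsSplit (insert x S) B ∨ Gᶜ.IsSplit (insert x S) B := by
  classical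
  by_cases hall : ∀ y ∈ S, G.Adj x y
  · obtain ⟨a, ha⟩ := hA.2.1
    refine ⟨{x}, .inr ⟨by simp, by simp, ⟨a, by simp [hA.1 ha], ?_⟩, ?_⟩⟩
    · rintro h
      exact hx (Finset.mem_singleton.1 h ▸ hA.1 ha)
    · intro b hb c hc hc' hbc
      rw [Finset.mem_singleton] at hb hc'
      subst hb
      exact hbc.2 (hall c (Finset.mem_of_mem_insert_of_ne hc hc'))
  · push Not at hall
    obtain ⟨y, hyS, hy⟩ := hall
    wlog hyA : y ∈ A generalizing A
    · exact this hA.sdiff (by simp [hyS, hyA])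
    obtain ⟨hAS, hne, ⟨b, hbS, hbA⟩, hsep⟩ := hA
    by_cases hz : ∃ z ∈ S, z ∉ A ∧ G.Adj x z
    · obtain ⟨z, hzS, hzA, hxz⟩ := hz
      refine ⟨A.filter fun u => ¬G.Adj x u, .inl ⟨?_, ⟨y, by simp [hyA, hy]⟩, ?_, ?_⟩⟩
      · exact (Finset.filter_subset _ _).trans (hAS.trans (Finset.subset_insert _ _))
      · exact ⟨z, by simp [hzS], by simp [hzA]⟩
      · intro u hu t ht ht' hut
        rw [Finset.mem_filter] at hu ht'
        rcases Finset.mem_insert.1 ht with rfl | htS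
        · exact hu.2 hut.symm
        by_cases htA : t ∈ A
        · have hxt : G.Adj x t := by
            by_contra h
            exact ht' ⟨htA, h⟩
          exact hsep u hu.1 z hzS hzA (hS (by simp [hAS hu.1]) ht (by simp) (by simp [hzS]) hut
            hxt.symm hxz (fun h => hu.2 h.symm) (hsep t htA z hzS hzA))
        · exact hsep u hu.1 t htS htA hut
    · push Not at hz
      refine ⟨S \ A, .inl ⟨?_, ⟨b, by simp [hbS, hbA]⟩, ⟨x, by simp, by simp [hx]⟩, ?_⟩⟩
      · exact Finset.sdiff_subset.trans (Finset.subset_insert _ _)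
      · intro u hu t ht ht' hut
        rw [Finset.mem_sdiff] at hu ht'
        rcases Finset.mem_insert.1 ht with rfl | htS
        · exact hz u hu.1 hu.2 hut.symm
        · have htA : t ∈ A := by
            by_contra h
            exact ht' ⟨htS, h⟩
          exact hsep t htA u hu.1 hu.2 hut.symm

/-- Seinsche's theorem: a `P₄`-free graph on at least two vertices is disconnected, or its
complement is. -/
theorem IsPFourFree.exists_isSplit {S : Finset V} (hS : G.IsPFourFree S) (h2 : 2 ≤ S.card) :
    ∃ A, G.IsSplit S A ∨ Gᶜ.IsSplit S A := by
  induction S using Finset.induction with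
  | empty => simp at h2
  | insert x S hx ih =>
    rw [Finset.card_insert_of_notMem hx] at h2
    rcases (show 1 ≤ S.card by omega).eq_or_lt with h1 | h1
    · obtain ⟨y, rfl⟩ := Finset.card_eq_one.1 h1.symm
      have hxy : x ≠ y := by simpa using hx
      refine ⟨{x}, ?_⟩
      by_cases h : G.Adj x y
      · right
        refine ⟨by simp, by simp, ⟨y, by simp, by simpa using hxy.symm⟩, ?_⟩
        simp [h]
      · left
        refine ⟨by simp, by simp, ⟨y, by simp, by simpa using hxy.symm⟩, ?_⟩
        simp [h]
    · obtain ⟨A, hA | hA⟩ := ih (hS.mono (Finset.subset_insert _ _)) h1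
      · exact hA.exists_insert hx hS
      · obtain ⟨B, hB⟩ := hA.exists_insert hx hS.compl
        exact ⟨B, by rwa [compl_compl, or_comm] at hB⟩

/-- Adjacency across a split is constant, so twins within one side are twins in `S`. If both sides
are single vertices, these are twins trivially. -/
theorem IsPFourFree.exists_twins {S : Finset V} (hS : G.IsPFourFree S) (h2 : 2 ≤ S.card) :
    ∃ a ∈ S, ∃ b ∈ S, a ≠ b ∧ ∀ c ∈ S, c ≠ a → c ≠ b → (G.Adj a c ↔ G.Adj b c) := by
  induction S using Finset.strongInduction with
  | H S ih =>
    obtain ⟨A, hA⟩ := hS.exists_isSplit h2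
    have hAS : A ⊆ S := hA.elim And.left And.left
    obtain ⟨a, ha⟩ : A.Nonempty := hA.elim (·.2.1) (·.2.1)
    obtain ⟨b, hbS, hbA⟩ : ∃ b ∈ S, b ∉ A := hA.elim (·.2.2.1) (·.2.2.1)
    have hunif : ∀ a ∈ A, ∀ a' ∈ A, ∀ b ∈ S, b ∉ A → ∀ b' ∈ S, b' ∉ A →
        (G.Adj a b ↔ G.Adj a' b') := by
      intro a ha a' ha' b hb hbA b' hb' hbA'
      rcases hA with hA | hA
      · exact iff_of_false (hA.2.2.2 a ha b hb hbA) (hA.2.2.2 a' ha' b' hb' hbA')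
      · have h : ∀ a ∈ A, ∀ b ∈ S, b ∉ A → G.Adj a b := by
          intro a ha b hb hbA
          by_contra h
          exact hA.2.2.2 a ha b hb hbA ⟨fun e => hbA (e ▸ ha), h⟩
        exact iff_of_true (h a ha b hb hbA) (h a' ha' b' hb' hbA')
    by_cases hA2 : 2 ≤ A.card
    · obtain ⟨c, hc, d, hd, hcd, h⟩ := ih A
        ⟨hAS, fun h => hbA (h hbS)⟩ (hS.mono hAS) hA2
      refine ⟨c, hAS hc, d, hAS hd, hcd, fun e he hec hed => ?_⟩
      by_cases heA : e ∈ A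
      · exact h e heA hec hed
      · exact hunif c hc d hd e he heA e he heA
    by_cases hB2 : 2 ≤ (S \ A).card
    · obtain ⟨c, hc, d, hd, hcd, h⟩ := ih (S \ A)
        ⟨Finset.sdiff_subset, fun h => (Finset.mem_sdiff.1 (h (hAS ha))).2 ha⟩
        (hS.mono Finset.sdiff_subset) hB2
      rw [Finset.mem_sdiff] at hc hd
      refine ⟨c, hc.1, d, hd.1, hcd, fun e he hec hed => ?_⟩
      by_cases heA : e ∈ A
      · rw [G.adj_comm c, G.adj_comm d]
        exact hunif e heA e heA c hc.1 hc.2 d hd.1 hd.2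
      · exact h e (Finset.mem_sdiff.2 ⟨he, heA⟩) hec hed
    · refine ⟨a, hAS ha, b, hbS, fun e => hbA (e ▸ ha), fun c hc hca hcb => ?_⟩
      by_cases hcA : c ∈ A
      · exact absurd (Finset.one_lt_card.2 ⟨c, hcA, a, ha, hca⟩) hA2
      · exact absurd (Finset.one_lt_card.2 ⟨c, Finset.mem_sdiff.2 ⟨hc, hcA⟩, b,
          Finset.mem_sdiff.2 ⟨hbS, hbA⟩, hcb⟩) hB2

end SimpleGraph

/-! ### Distance levels and the reduction. -/

namespace SimpleGraph

variable {V : Type*} {G : SimpleGraph V}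

namespace IsDistanceHereditary

/-- If two vertices of one level are joined by a walk that stays at or above that level, then they
have the same neighbours in the level below. -/
theorem adj_of_walk (hG : G.IsDistanceHereditary) {r x u w : V} (q : G.Walk u w)
    (hrx : G.Reachable r x) (hxu : G.Adj x u) (hq : ∀ s ∈ q.support, G.dist r x < G.dist r s)
    (hw : G.dist r w = G.dist r x + 1) : G.Adj x w := by
  classical
  obtain ⟨p, hp⟩ := hrx.exists_walk_length_eq_dist
  -- The last vertex `s` of the geodesic `t` before `w` is in the level of `x`. It is not on `q`,
  -- which stays higher, so it lies on the geodesic `p`, whose only vertex in that level is `x`.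
  obtain ⟨t, hts, ht⟩ := hG.exists_walk_length_eq_dist (p.append (.cons hxu q))
  have hadj := t.adj_getVert_succ (i := G.dist r x) (by omega)
  rw [show G.dist r x + 1 = t.length by omega, t.getVert_length] at hadj
  set s := t.getVert (G.dist r x) with hs
  have hle : G.dist r s ≤ G.dist r x :=
    (dist_le (t.take (G.dist r x))).trans (by rw [t.take_length]; exact min_le_left _ _)
  have hge := hadj.diff_dist_adj (u := r)
  have hsp : s ∈ p.support := by
    have := hts (t.getVert_mem_support (G.dist r x))
    rw [Walk.mem_support_append_iff, Walk.support_cons, List.mem_cons] at this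
    rcases this with h | h | h
    · exact h
    · rw [← hs] at h
      rw [h]
      exact p.end_mem_support
    · exact absurd (hq s h) (by omega)
  have hsx : s = x := by
    by_contra hne
    have h₁ := Walk.length_takeUntil_lt_length hsp hne
    have h₂ := dist_le (p.takeUntil s hsp)
    omega
  rwa [hsx] at hadj

end IsDistanceHereditary

/-- Reachability is recorded because `dist` is also `0` between different components, which matters
for `k = 0`. -/
theorem exists_adj_dist_eq {r v : V} {k : ℕ} (h : G.dist r v = k + 1) :
    ∃ x, G.Adj x v ∧ G.dist r x = k ∧ G.Reachable r x := by
  obtain ⟨p, hp⟩ := exists_walk_of_dist_ne_zero (G := G) (u := r) (v := v) (by omega)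
  have hadj := p.adj_getVert_succ (i := k) (by omega)
  rw [show k + 1 = p.length by omega, p.getVert_length] at hadj
  refine ⟨_, hadj, ?_, (p.take k).reachable⟩
  have h₁ := (dist_le (p.take k)).trans_eq (p.take_length k)
  have h₂ := hadj.diff_dist_adj (u := r)
  omega

/-- `G` has an isolated vertex, a pendant vertex, or a pair of twins. -/
def HasReduction (G : SimpleGraph V) : Prop :=
  ∃ v, (∀ b, ¬G.Adj v b) ∨ (∃ u, G.Adj v u ∧ ∀ b, G.Adj v b → b = u) ∨
    ∃ u, v ≠ u ∧ ∀ b, b ≠ v → b ≠ u → (G.Adj v b ↔ G.Adj u b)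

namespace IsDistanceHereditary

theorem hasReduction_of_module [Finite V] (hG : G.IsDistanceHereditary) {S : Set V} {v : V}
    (hv : ∀ s ∈ S, G.Adj v s) (hS : S.Nontrivial)
    (hmod : ∀ a ∈ S, ∀ b ∈ S, ∀ c ∉ S, G.Adj a c → G.Adj b c) : G.HasReduction := by
  classical
  have hfin := S.toFinite
  have h2 : 2 ≤ hfin.toFinset.card := by
    obtain ⟨a, ha, b, hb, hab⟩ := hS
    exact Finset.one_lt_card.2 ⟨a, by simpa, b, by simpa, hab⟩
  obtain ⟨a, ha, b, hb, hab, h⟩ := (hG.isPFourFree_of_forall_adj (S := hfin.toFinset) (v := v)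
    (by simpa using hv)).exists_twins h2
  rw [Set.Finite.mem_toFinset] at ha hb
  refine ⟨a, .inr (.inr ⟨b, hab, fun c hca hcb => ?_⟩)⟩
  by_cases hc : c ∈ S
  · exact h c (by simpa) hca hcb
  · exact ⟨hmod a ha b hb c hc, hmod b hb a ha c hc⟩

theorem hasReduction_of_adj_last_level [Finite V] (hG : G.IsDistanceHereditary) {r u w : V}
    {k : ℕ} (hmax : ∀ z, G.dist r z ≤ k + 1) (hu : G.dist r u = k + 1) (hw : G.dist r w = k + 1)
    (huw : G.Adj u w) : G.HasReduction := by
  obtain ⟨x, hxu, hx, hrx⟩ := exists_adj_dist_eq hu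
  -- The component of `u` in the last level.
  let S : Set V := {z | ∃ q : G.Walk u z, ∀ s ∈ q.support, G.dist r s = k + 1}
  have hlev : ∀ z ∈ S, G.dist r z = k + 1 := fun z ⟨q, hq⟩ => hq z q.end_mem_support
  have hsame : ∀ a ∈ S, ∀ b ∈ S, ∀ c, G.dist r c = k → G.Reachable r c → G.Adj c a →
      G.Adj c b := by
    rintro a ⟨p, hp⟩ b ⟨q, hq⟩ c hc hrc hca
    refine hG.adj_of_walk (p.reverse.append q) hrc hca (fun s hs => ?_) ?_
    · rw [Walk.mem_support_append_iff, Walk.support_reverse, List.mem_reverse] at hs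
      rw [hs.elim (hp s) (hq s)]
      omega
    · rw [hc]
      exact hq b q.end_mem_support
  have huS : u ∈ S := ⟨.nil, by simpa using hu⟩
  have hwS : w ∈ S := ⟨.cons huw .nil, by simp [hu, hw]⟩
  refine hG.hasReduction_of_module (S := S) (v := x)
    (fun s hs => hsame u huS s hs x hx hrx hxu) ⟨u, huS, w, hwS, huw.ne⟩ ?_
  intro a ha b hb c hc hac
  have hca := hac.diff_dist_adj (u := r)
  have hcmax := hmax c
  have hla := hlev a ha
  have hck : G.dist r c = k := by
    by_contra hne
    have hck : G.dist r c = k + 1 := by omega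
    obtain ⟨q, hq⟩ := ha
    refine hc ⟨q.concat hac, fun s hs => ?_⟩
    rw [Walk.support_concat, List.mem_append, List.mem_singleton] at hs
    rcases hs with hs | rfl
    · exact hq s hs
    · exact hck
  have hra : G.Reachable r a := .of_dist_ne_zero (by omega)
  exact (hsame a ha b hb c hck (hra.trans hac.reachable) hac.symm).symm

theorem hasReduction_of_independent_last_level [Finite V] (hG : G.IsDistanceHereditary) {r : V}
    {k : ℕ} (hmax : ∀ z, G.dist r z ≤ k + 1) (hex : ∃ v, G.dist r v = k + 1)
    (hind : ∀ u w, G.dist r u = k + 1 → G.dist r w = k + 1 → ¬G.Adj u w) : G.HasReduction := by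
  obtain ⟨v, hv, hvmin⟩ := Set.exists_min_image {v | G.dist r v = k + 1}
    (fun v => (G.neighborSet v).ncard) (Set.toFinite _) hex
  change G.dist r v = k + 1 at hv
  have hbelow : ∀ {v s}, G.dist r v = k + 1 → G.Adj v s → G.dist r s = k := by
    intro v s hv hs
    have h₁ := hs.diff_dist_adj (u := r)
    have h₂ := hmax s
    have h₃ := mt (fun h => hind v s hv h) (not_not.2 hs)
    omega
  have hrv : G.Reachable r v := .of_dist_ne_zero (by omega)
  by_cases hS : (G.neighborSet v).Nontrivial
  · refine hG.hasReduction_of_module (S := G.neighborSet v) (v := v) (fun s hs => hs) hS ?_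
    intro a ha b hb c hc hac
    change G.Adj v a at ha
    change G.Adj v b at hb
    change ¬G.Adj v c at hc
    have hka := hbelow hv ha
    have hkb := hbelow hv hb
    have hrc : G.Reachable r c := hrv.trans (ha.reachable.trans hac.reachable)
    by_contra hbc
    have hab : a ≠ b := by
      rintro rfl
      exact hbc hac
    have hvc : v ≠ c := by
      rintro rfl
      exact hbc hb.symm
    have hra : G.Reachable r a := hrv.trans ha.reachable
    have hrb : G.Reachable r b := hrv.trans hb.reachable
    -- For `k = 0` both `a` and `b` would be `r`. So `b` has a neighbour `y` one level below.
    obtain ⟨j, rfl⟩ : ∃ j, k = j + 1 := by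
      refine Nat.exists_eq_succ_of_ne_zero fun hk => hab ?_
      rw [hk] at hka hkb
      exact (hra.dist_eq_zero_iff.1 hka).symm.trans (hrb.dist_eq_zero_iff.1 hkb)
    obtain ⟨y, hyb, hy, hry⟩ := exists_adj_dist_eq hkb
    have hvy : ¬G.Adj v y := fun h => by
      have := hbelow hv h
      omega
    have hca := hac.diff_dist_adj (u := r)
    have hcmax := hmax c
    -- In the first case the walk `a v b` stays above `c` and forces `c` to see `b`. In the others
    -- `v a c` is an induced path, and a walk from `v` to `c` through `b` and `y` is found that
    -- contains no common neighbour of `v` and `c`.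
    rcases (show G.dist r c = j ∨ G.dist r c = j + 1 ∨ G.dist r c = j + 2 by omega) with h | h | h
    · refine hbc (hG.adj_of_walk (.cons ha.symm (.cons hb .nil)) hrc hac.symm ?_ ?_).symm
      · simp [h, hka, hkb, hv]
      · omega
    · have hyc : G.Adj y c := by
        refine hG.adj_of_walk (.cons hb.symm (.cons ha (.cons hac .nil))) hry hyb ?_ ?_
        · simp [h, hka, hkb, hv, hy]
        · omega
      obtain ⟨s, hs, h₁, h₂⟩ := hG.exists_common_neighbor
        (.cons hb (.cons hyb.symm (.cons hyc .nil))) hvc hc ha hac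
      simp only [Walk.support_cons, Walk.support_nil, List.mem_cons, List.not_mem_nil,
        or_false] at hs
      rcases hs with rfl | rfl | rfl | rfl
      · exact G.irrefl h₁
      · exact hbc h₂
      · exact hvy h₁
      · exact hc h₁
    -- Since `b` is a neighbour of `v` but not of `c`, the minimal choice of `v` forbids that every
    -- neighbour of `c` is one of `v`.
    · obtain ⟨w, hcw, hvw⟩ : ∃ w, G.Adj c w ∧ ¬G.Adj v w := by
        by_contra! hsub
        have hlt : (G.neighborSet c).ncard < (G.neighborSet v).ncard :=
          Set.ncard_lt_ncard ⟨hsub, fun hle => hbc (hle hb : G.Adj c b).symm⟩ (Set.toFinite _)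
        exact absurd (hvmin c h) (not_le.2 hlt)
      have hkw := hbelow h hcw
      have hyw : G.Adj y w := by
        refine hG.adj_of_walk (.cons hb.symm (.cons ha (.cons hac (.cons hcw .nil)))) hry hyb ?_ ?_
        · simp [h, hka, hkb, hv, hy, hkw]
        · omega
      obtain ⟨s, hs, h₁, h₂⟩ := hG.exists_common_neighbor
        (.cons hb (.cons hyb.symm (.cons hyw (.cons hcw.symm .nil)))) hvc hc ha hac
      simp only [Walk.support_cons, Walk.support_nil, List.mem_cons, List.not_mem_nil,
        or_false] at hs
      rcases hs with rfl | rfl | rfl | rfl | rfl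
      · exact G.irrefl h₁
      · exact hbc h₂
      · exact hvy h₁
      · exact hvw h₁
      · exact hc h₁
  · rw [Set.not_nontrivial_iff] at hS
    obtain ⟨x, hxv, -, -⟩ := exists_adj_dist_eq hv
    exact ⟨v, .inr (.inl ⟨x, hxv.symm, fun b hb => hS hb hxv.symm⟩)⟩

/-- Every nonempty distance-hereditary graph has an isolated vertex, a pendant vertex, or a pair
of twins. -/
theorem hasReduction [Finite V] [Nonempty V] (hG : G.IsDistanceHereditary) : G.HasReduction := by
  obtain ⟨r⟩ := ‹Nonempty V›
  obtain ⟨v, hv⟩ := Finite.exists_max (G.dist r)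
  rcases hk : G.dist r v with _ | k
  -- Maximal `dist` equal to `0` allows other components, but a neighbour of `r` would be at
  -- distance `1`.
  · refine ⟨r, .inl fun b hb => ?_⟩
    have := hv b
    rw [hk, dist_eq_one_iff_adj.2 hb] at this
    omega
  · rw [hk] at hv
    by_cases h : ∃ u w, G.dist r u = k + 1 ∧ G.dist r w = k + 1 ∧ G.Adj u w
    · obtain ⟨u, w, hu, hw, huw⟩ := h
      exact hG.hasReduction_of_adj_last_level hv hu hw huw
    · push Not at h
      exact hG.hasReduction_of_independent_last_level hv ⟨v, hk⟩ h

end IsDistanceHereditary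

end SimpleGraph

theorem mainTheorem3 {V : Type*} [Finite V] (G : SimpleGraph V)
    (hG : G.IsDistanceHereditary) : G.IsLGraph := by
  classical
  induction h : Nat.card V generalizing V with
  | zero =>
    have : IsEmpty V := (Nat.card_eq_zero.1 h).resolve_right (not_infinite_iff_finite.2 ‹_›)
    exact ⟨isEmptyElim, isEmptyElim, fun u => isEmptyElim u⟩
  | succ n ih =>
    have : Nonempty V := (Nat.card_pos_iff.1 (by omega)).1
    obtain ⟨v, hv⟩ := hG.hasReduction
    have hcard : Nat.card ({v}ᶜ : Set V) = n := by
      have := Set.ncard_add_ncard_compl {v}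
      rw [Set.ncard_singleton, h] at this
      rw [Nat.card_coe_set_eq]
      omega
    obtain ⟨L, hL⟩ := ih _ (hG.induce {v}ᶜ) hcard
    rw [SimpleGraph.isLEmbedding_iff] at hL
    let L' : V → LSegment := fun a =>
      if ha : a ≠ v then L ⟨a, ha⟩ else ⟨0, 0, 1, 1, one_pos, one_pos⟩
    have hL' : ∀ a b, a ≠ v → b ≠ v → a ≠ b →
        LSegment.Represents (G.Adj a b) (L' a) (L' b) := by
      intro a b ha hb hab
      simpa [L', ha, hb] using hL ⟨a, ha⟩ ⟨b, hb⟩ (fun e => hab (congrArg Subtype.val e))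
    rcases hv with hv | ⟨u, huv, hv⟩ | ⟨u, huv, hv⟩
    · exact SimpleGraph.isLGraph_of_isolated hL' hv
    · exact SimpleGraph.isLGraph_of_pendant huv hL' hv
    · exact SimpleGraph.isLGraph_of_twin huv hL' hv
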